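/- **A generalized Jeroslow–Lowe theorem.** A *rational generalized polyhedron* in $\mathbb{R}^n$ is a set of the form $\{x\in\mathbb{R}^n : Ax\le b,\ Cx<d\}$ (finitely many inequalities) with $A,b,C,d$ rational; it is a *rational generalized polytope* if it is bounded, and a bounded rational generalized polyhedron that equals its relative interior (its interior in the topology of its affine hull) is a *rational relatively open polytope*. A *rational generalized mixed-integer set* in $\mathbb{R}^m$ is a set $\{x\in P : x_i\in\mathbb{Z}\text{ for all } i\in I\}$, where $P\subseteq\mathbb{R}^m$ is a rational generalized polyhedron and $I\subseteq\{1,\dots,m\}$. A subset of $\mathbb{R}^n$ is *rational generalized-MILP-representable* if it is the image of such a set, for some $m$, under a linear map $\mathbb{R}^m\to\mathbb{R}^n$ given by a rational matrix. A *rational finitely generated monoid* in $\mathbb{R}^n$ is a set $\{\sum_{i=1}^k\lambda_i r^i : \lambda_1,\dots,\lambda_k\in\mathbb{Z}_{\ge 0}\}$ with $k\ge 0$ and $r^1,\dots,r^k\in\mathbb{Q}^n$. Finite unions may be empty. For every $n\ge 0$ and every $S\subseteq\mathbb{R}^n$ the following are equivalent: 1. for some $m$, $S$ is the image, under a linear map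 $\mathbb{R}^m\to\mathbb{R}^n$ given by a rational matrix, of a finite union of rational generalized mixed-integer sets in $\mathbb{R}^m$; 2. $S$ is a finite union of rational generalized-MILP-representable sets in $\mathbb{R}^n$; 3. $S$ is a finite union of sets, each of which is the Minkowski sum $P+M$ of a rational relatively open polytope $P\subseteq\mathbb{R}^n$ and a rational finitely generated monoid $M\subseteq\mathbb{R}^n$; 4. $S$ is a finite union of sets, each of which is the Minkowski sum $P+M$ of a rational generalized polytope $P\subseteq\mathbb{R}^n$ and a rational finitely generated monoid $M\subseteq\mathbb{R}^n$. -/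

import Mathlib

open scoped Pointwise

namespace GenMILP

/-- A family of subsets of the spaces `ℝⁿ`, with members in every dimension `n`. -/
abbrev SetFamily : Type := ∀ n : ℕ, Set (Set (Fin n → ℝ))

/-- The rational generalized polyhedra: finite intersections of closed and open halfspaces given by
affine functions with rational data, `{x : A x ≤ b, C x < d}` with `A, b, C, d` rational. -/
def ratGenPolyhedra : SetFamily := fun n =>
  {P | ∃ (p q : ℕ) (A : Matrix (Fin p) (Fin n) ℚ) (b : Fin p → ℚ)
      (C : Matrix (Fin q) (Fin n) ℚ) (d : Fin q → ℚ),
      P = {x | (∀ i, ∑ j, (A i j : ℝ) * x j ≤ (b i : ℝ)) ∧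
               (∀ i, ∑ j, (C i j : ℝ) * x j < (d i : ℝ))}}

/-- The rational generalized polytopes: bounded rational generalized polyhedra. -/
def ratGenPolytopes : SetFamily := fun n =>
  {P | P ∈ ratGenPolyhedra n ∧ Bornology.IsBounded P}

/-- The rational relatively open polyhedra: rational generalized polyhedra that are equal to their
relative interior (the interior in the relative topology of the affine hull). -/
def ratRelOpenPolyhedra : SetFamily := fun n =>
  {P | P ∈ ratGenPolyhedra n ∧ intrinsicInterior ℝ P = P}

/-- The rational relatively open polytopes: bounded rational relatively open polyhedra. -/
def ratRelOpenPolytopes : SetFamily := fun n =>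
  {P | P ∈ ratRelOpenPolyhedra n ∧ Bornology.IsBounded P}

/-- The rational generalized mixed-integer sets: the points of a rational generalized polyhedron
whose coordinates in some set `I` of indices are integers. -/
def ratGenMixedIntegerSets : SetFamily := fun n =>
  {T | ∃ P ∈ ratGenPolyhedra n, ∃ I : Set (Fin n),
      T = {x | x ∈ P ∧ ∀ i ∈ I, ∃ z : ℤ, x i = (z : ℝ)}}

/-- The rational finitely generated monoids: all nonnegative integer combinations of finitely many
rational vectors. -/
def ratFGMonoids : SetFamily := fun n =>
  {M | ∃ (k : ℕ) (r : Fin k → Fin n → ℚ),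
      M = {x | ∃ c : Fin k → ℕ, ∀ j, x j = ∑ i, (c i : ℝ) * (r i j : ℝ)}}

/-- The finite unions of members (of the same ambient space) of a family. -/
def finiteUnions (𝒯 : SetFamily) : SetFamily := fun n =>
  {S | ∃ (k : ℕ) (F : Fin k → Set (Fin n → ℝ)), (∀ i, F i ∈ 𝒯 n) ∧ S = ⋃ i, F i}

/-- The images of members of a family, of any dimension, under linear maps `ℝᵐ → ℝⁿ` given by
rational matrices. -/
def ratRepresentable (𝒯 : SetFamily) : SetFamily := fun n =>
  {S | ∃ (m : ℕ) (T : Set (Fin m → ℝ)) (L : Matrix (Fin n) (Fin m) ℚ),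
      T ∈ 𝒯 m ∧ S = (fun x : Fin m → ℝ => fun i => ∑ j, (L i j : ℝ) * x j) '' T}

/-- The Minkowski sums of a member of one family and a member of another one. -/
def minkowskiSums (𝒯 𝒰 : SetFamily) : SetFamily := fun n =>
  {S | ∃ P ∈ 𝒯 n, ∃ M ∈ 𝒰 n, S = P + M}

end GenMILP

/-! The heart is that a projected mixed-integer set is a finite union of sums P + M with P a bounded
polyhedron and M a finitely generated monoid. Homogenizing a rational generalized polyhedron gives a
cone with finitely many integer generators (`exists_integer_generators`, by double description).
Splitting integer parts off the coefficients of the recession generators writes each point as a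
point of a bounded part plus an integer combination of integer vectors
(`IsRatGenPoly.exists_integer_recession`). This translation preserves integrality, so the
constrained coordinates of the bounded part take finitely many values
(`IsRatGenPoly.exists_mixedInteger_eq_iUnion`). Projecting keeps this form because rational linear
images of generalized polyhedra are again such (`IsRatGenPoly.image`, by Fourier–Motzkin elimination
with strict inequalities).

Conversely, P + M is a projection of P × ℤ≥0^k. Relatively open pieces come from splitting each ≤
into = and <, and images of several sets are merged into one image by stacking the source spaces. -/

namespace GenMILP

/-! ### Rational forms, halfspaces and generalized polyhedra over arbitrary finite index types -/

section Basic

variable {ι κ : Type} [Fintype ι]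

/-- The linear form `x ↦ ∑ i, a i * x i` with rational coefficients. -/
noncomputable def ratForm (a : ι → ℚ) : (ι → ℝ) →ₗ[ℝ] ℝ where
  toFun x := ∑ i, (a i : ℝ) * x i
  map_add' x y := by simp [mul_add, Finset.sum_add_distrib]
  map_smul' c x := by
    simp only [Pi.smul_apply, smul_eq_mul, RingHom.id_apply, Finset.mul_sum]
    exact Finset.sum_congr rfl fun i _ => by ring

theorem ratForm_apply (a : ι → ℚ) (x : ι → ℝ) : ratForm a x = ∑ i, (a i : ℝ) * x i := rfl

theorem continuous_ratForm (a : ι → ℚ) : Continuous (ratForm a) :=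
  LinearMap.continuous_of_finiteDimensional _

theorem ratForm_add (a b : ι → ℚ) (x : ι → ℝ) :
    ratForm (a + b) x = ratForm a x + ratForm b x := by
  simp [ratForm_apply, add_mul, Finset.sum_add_distrib]

theorem ratForm_smul (c : ℚ) (a : ι → ℚ) (x : ι → ℝ) :
    ratForm (c • a) x = c * ratForm a x := by
  simp [ratForm_apply, Finset.mul_sum, mul_assoc]

theorem ratForm_neg (a : ι → ℚ) (x : ι → ℝ) : ratForm (-a) x = -ratForm a x := by
  simp [ratForm_apply]

theorem ratForm_zero (x : ι → ℝ) : ratForm (0 : ι → ℚ) x = 0 := by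
  simp [ratForm_apply]

theorem ratForm_single [DecidableEq ι] (i : ι) (x : ι → ℝ) :
    ratForm (Pi.single i 1) x = x i := by
  rw [ratForm_apply, Finset.sum_eq_single i]
  · simp
  · intro j _ hj
    simp [hj]
  · simp

theorem ratForm_ratCast (a v : ι → ℚ) :
    ratForm a (fun i => (v i : ℝ)) = ((∑ i, a i * v i : ℚ) : ℝ) := by
  simp [ratForm_apply]

/-- The linear map given by a rational matrix. -/
noncomputable def ratMap (L : Matrix κ ι ℚ) : (ι → ℝ) →ₗ[ℝ] (κ → ℝ) :=
  LinearMap.pi fun k => ratForm (L k)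

theorem ratMap_apply (L : Matrix κ ι ℚ) (x : ι → ℝ) (k : κ) :
    ratMap L x k = ∑ i, (L k i : ℝ) * x i := rfl

theorem ratForm_ratMap [Fintype κ] (a : κ → ℚ) (L : Matrix κ ι ℚ) (x : ι → ℝ) :
    ratForm a (ratMap L x) = ratForm (fun i => ∑ k, a k * L k i) x := by
  simp only [ratForm_apply, ratMap_apply, Finset.mul_sum, Rat.cast_sum, Rat.cast_mul,
    Finset.sum_mul]
  rw [Finset.sum_comm]
  exact Finset.sum_congr rfl fun i _ => Finset.sum_congr rfl fun k _ => by ring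

/-- Closed and open halfspaces with rational data (the form may vanish). -/
def IsRatHalfspace (H : Set (ι → ℝ)) : Prop :=
  ∃ (a : ι → ℚ) (b : ℚ), H = {x | ratForm a x ≤ b} ∨ H = {x | ratForm a x < b}

/-- Finite intersections of rational closed and open halfspaces, over an arbitrary index type. -/
def IsRatGenPoly (P : Set (ι → ℝ)) : Prop :=
  ∃ 𝓗 : Set (Set (ι → ℝ)), 𝓗.Finite ∧ (∀ H ∈ 𝓗, IsRatHalfspace H) ∧ P = ⋂₀ 𝓗

theorem isRatHalfspace_le (a : ι → ℚ) (b : ℚ) : IsRatHalfspace {x | ratForm a x ≤ b} :=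
  ⟨a, b, Or.inl rfl⟩

theorem isRatHalfspace_lt (a : ι → ℚ) (b : ℚ) : IsRatHalfspace {x | ratForm a x < b} :=
  ⟨a, b, Or.inr rfl⟩

theorem IsRatHalfspace.convex {H : Set (ι → ℝ)} (h : IsRatHalfspace H) : Convex ℝ H := by
  obtain ⟨a, b, rfl | rfl⟩ := h
  · exact convex_halfSpace_le (ratForm a).isLinear _
  · exact convex_halfSpace_lt (ratForm a).isLinear _

theorem IsRatHalfspace.isRatGenPoly {H : Set (ι → ℝ)} (h : IsRatHalfspace H) :
    IsRatGenPoly H :=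
  ⟨{H}, Set.finite_singleton H, by simpa using h, by simp⟩

theorem isRatGenPoly_univ : IsRatGenPoly (Set.univ : Set (ι → ℝ)) :=
  ⟨∅, Set.finite_empty, by simp, by simp⟩

theorem IsRatGenPoly.iInter {σ : Type*} [Finite σ] {P : σ → Set (ι → ℝ)}
    (h : ∀ s, IsRatGenPoly (P s)) : IsRatGenPoly (⋂ s, P s) := by
  choose 𝓗 hfin hH hP using h
  refine ⟨⋃ s, 𝓗 s, Set.finite_iUnion hfin, ?_, ?_⟩
  · intro H hmem
    obtain ⟨s, hs⟩ := Set.mem_iUnion.1 hmem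
    exact hH s H hs
  · rw [Set.sInter_iUnion]
    exact Set.iInter_congr hP

theorem IsRatGenPoly.inter {P Q : Set (ι → ℝ)} (hP : IsRatGenPoly P) (hQ : IsRatGenPoly Q) :
    IsRatGenPoly (P ∩ Q) := by
  rw [Set.inter_eq_iInter]
  exact IsRatGenPoly.iInter fun b => by cases b <;> assumption

theorem isRatGenPoly_eq (a : ι → ℚ) (b : ℚ) : IsRatGenPoly {x | ratForm a x = b} := by
  convert (isRatHalfspace_le a b).isRatGenPoly.inter (isRatHalfspace_le (-a) (-b)).isRatGenPoly
    using 1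
  ext x
  simp [ratForm_neg, le_antisymm_iff]

theorem isRatGenPoly_coord_eq (i : ι) (b : ℚ) : IsRatGenPoly {x : ι → ℝ | x i = b} := by
  classical
  simpa only [ratForm_single] using isRatGenPoly_eq (Pi.single i 1) b

theorem isRatGenPoly_coord_le (i : ι) (b : ℚ) : IsRatGenPoly {x : ι → ℝ | x i ≤ b} := by
  classical
  simpa only [ratForm_single] using (isRatHalfspace_le (Pi.single i 1) b).isRatGenPoly

theorem isRatGenPoly_coord_ge (i : ι) (b : ℚ) : IsRatGenPoly {x : ι → ℝ | (b : ℝ) ≤ x i} := by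
  classical
  simpa only [ratForm_neg, ratForm_single, Rat.cast_neg, neg_le_neg_iff] using
    (isRatHalfspace_le (-Pi.single i 1) (-b)).isRatGenPoly

theorem IsRatHalfspace.preimage [Fintype κ] {H : Set (κ → ℝ)} (h : IsRatHalfspace H) (L : Matrix κ ι ℚ) :
    IsRatHalfspace (ratMap L ⁻¹' H) := by
  obtain ⟨a, b, rfl | rfl⟩ := h
  · refine ⟨fun i => ∑ k, a k * L k i, b, Or.inl ?_⟩
    ext x
    simp [ratForm_ratMap]
  · refine ⟨fun i => ∑ k, a k * L k i, b, Or.inr ?_⟩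
    ext x
    simp [ratForm_ratMap]

theorem IsRatGenPoly.preimage [Fintype κ] {P : Set (κ → ℝ)} (h : IsRatGenPoly P) (L : Matrix κ ι ℚ) :
    IsRatGenPoly (ratMap L ⁻¹' P) := by
  obtain ⟨𝓗, hfin, hH, rfl⟩ := h
  have := hfin.to_subtype
  rw [Set.sInter_eq_iInter, Set.preimage_iInter]
  exact IsRatGenPoly.iInter fun H => ((hH H H.2).preimage L).isRatGenPoly

theorem isRatGenPoly_preimage_comp [Fintype κ] {P : Set (κ → ℝ)} (h : IsRatGenPoly P) (e : κ → ι) :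
    IsRatGenPoly {x : ι → ℝ | x ∘ e ∈ P} := by
  classical
  convert h.preimage (fun k => Pi.single (e k) 1) using 1
  ext x
  have : ratMap (fun k => Pi.single (e k) 1) x = x ∘ e := by
    ext k
    exact ratForm_single (e k) x
  simp [this]

theorem mem_ratGenPolyhedra_of_finite {n : ℕ} {σ τ : Type*} [Finite σ] [Finite τ]
    (A : σ → Fin n → ℚ) (b : σ → ℚ) (C : τ → Fin n → ℚ) (d : τ → ℚ) :
    {x | (∀ s, ratForm (A s) x ≤ b s) ∧ ∀ t, ratForm (C t) x < d t} ∈ ratGenPolyhedra n := by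
  obtain ⟨p, ⟨e⟩⟩ := Finite.exists_equiv_fin σ
  obtain ⟨q, ⟨f⟩⟩ := Finite.exists_equiv_fin τ
  refine ⟨p, q, fun i => A (e.symm i), fun i => b (e.symm i), fun i => C (f.symm i),
    fun i => d (f.symm i), ?_⟩
  ext x
  exact and_congr e.symm.forall_congr_right.symm f.symm.forall_congr_right.symm

theorem mem_ratGenPolyhedra_iff {n : ℕ} {P : Set (Fin n → ℝ)} :
    P ∈ ratGenPolyhedra n ↔ IsRatGenPoly P := by
  constructor
  · rintro ⟨p, q, A, b, C, d, rfl⟩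
    convert (IsRatGenPoly.iInter fun i => (isRatHalfspace_le (A i) (b i)).isRatGenPoly).inter
      (IsRatGenPoly.iInter fun i => (isRatHalfspace_lt (C i) (d i)).isRatGenPoly) using 1
    ext x
    simp [ratForm_apply]
  · rintro ⟨𝓗, hfin, hH, rfl⟩
    have := hfin.to_subtype
    -- The two index subtypes may overlap, since a degenerate set can have both descriptions; this
    -- only repeats constraints.
    choose A b hA using fun H : {H : 𝓗 // ∃ a b, H.1 = {x | ratForm a x ≤ (b : ℚ)}} => H.2
    choose C d hC using fun H : {H : 𝓗 // ∃ a b, H.1 = {x | ratForm a x < (b : ℚ)}} => H.2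
    convert mem_ratGenPolyhedra_of_finite A b C d using 1
    ext x
    constructor
    · intro hx
      refine ⟨fun H => ?_, fun H => ?_⟩
      · have := hx H.1 H.1.2
        rwa [hA H] at this
      · have := hx H.1 H.1.2
        rwa [hC H] at this
    · rintro ⟨h₁, h₂⟩ H hmem
      obtain ⟨a, b', h | h⟩ := hH H hmem
      · have := h₁ ⟨⟨H, hmem⟩, a, b', h⟩
        have h' := hA ⟨⟨H, hmem⟩, a, b', h⟩
        simp only at h'
        rw [h']
        exact this
      · have := h₂ ⟨⟨H, hmem⟩, a, b', h⟩
        have h' := hC ⟨⟨H, hmem⟩, a, b', h⟩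
        simp only at h'
        rw [h']
        exact this

end Basic

end GenMILP

namespace GenMILP

/-! ### Fourier–Motzkin elimination with strict inequalities -/

section Projection

theorem eventually_atBot_add_mul_lt {α : ℝ} (hα : 0 < α) (p b : ℝ) :
    ∀ᶠ s in Filter.atBot, p + s * α < b := by
  filter_upwards [Filter.eventually_lt_atBot ((b - p) / α)] with s hs
  rw [lt_div_iff₀ hα] at hs
  linarith

theorem eventually_atTop_add_mul_lt {α : ℝ} (hα : α < 0) (p b : ℝ) :
    ∀ᶠ s in Filter.atTop, p + s * α < b := by
  filter_upwards [Filter.eventually_gt_atTop ((b - p) / α)] with s hs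
  rw [div_lt_iff_of_neg hα] at hs
  linarith

/-- The conditions bound s above by (b - p) / α and below by (b' - p') / α'; comparing these bounds
and clearing denominators eliminates s. -/
theorem exists_add_mul_le_and_le {α α' : ℝ} (hα : 0 < α) (hα' : α' < 0) (p p' b b' : ℝ) :
    (∃ s, p + s * α ≤ b ∧ p' + s * α' ≤ b') ↔ α * p' - α' * p ≤ α * b' - α' * b := by
  constructor
  · rintro ⟨s, h, h'⟩
    nlinarith
  · intro h
    refine ⟨(b - p) / α, ?_, ?_⟩
    · rw [div_mul_cancel₀ _ hα.ne']
      linarith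
    · refine le_of_mul_le_mul_left ?_ hα
      have : α * (p' + (b - p) / α * α') = α * p' + (b - p) * α' := by field_simp
      rw [this]
      linarith

theorem exists_add_mul_lt_and_lt {α α' : ℝ} (hα : 0 < α) (hα' : α' < 0) {p p' b b' : ℝ}
    (h : α * p' - α' * p < α * b' - α' * b) :
    ∃ s, p + s * α < b ∧ p' + s * α' < b' := by
  have key : (b' - p') / α' < (b - p) / α := by
    rw [div_lt_iff_of_neg hα', div_mul_eq_mul_div, div_lt_iff₀ hα]
    linarith
  obtain ⟨s, h₁, h₂⟩ := exists_between key
  refine ⟨s, ?_, ?_⟩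
  · rw [lt_div_iff₀ hα] at h₂
    linarith
  · rw [div_lt_iff_of_neg hα'] at h₁
    linarith

variable {ι κ : Type} [Fintype ι]

theorem ratForm_add_smul (a : ι → ℚ) (x v : ι → ℝ) (s : ℝ) :
    ratForm a (x + s • v) = ratForm a x + s * ratForm a v := by
  simp

theorem isRatGenPoly_exists_add_smul_mem_of_pos_of_neg {a a' : ι → ℚ} {b b' : ℚ}
    {H H' : Set (ι → ℝ)}
    (h : H = {x | ratForm a x ≤ b} ∨ H = {x | ratForm a x < b})
    (h' : H' = {x | ratForm a' x ≤ b'} ∨ H' = {x | ratForm a' x < b'})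
    (v : ι → ℚ) (hα : 0 < ∑ i, a i * v i) (hα' : ∑ i, a' i * v i < 0) :
    IsRatGenPoly {x | ∃ s : ℝ, x + s • (fun i => (v i : ℝ)) ∈ H ∩ H'} := by
  set α := ∑ i, a i * v i with hαdef
  set α' := ∑ i, a' i * v i with hα'def
  have hαr : (0 : ℝ) < α := by exact_mod_cast hα
  have hα'r : (α' : ℝ) < 0 := by exact_mod_cast hα'
  have e (x : ι → ℝ) : ratForm (α • a' - α' • a) x = α * ratForm a' x - α' * ratForm a x := by
    rw [sub_eq_add_neg, ratForm_add, ratForm_neg, ratForm_smul, ratForm_smul, ← sub_eq_add_neg]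
  have hlt : IsRatGenPoly {x : ι → ℝ | α * ratForm a' x - α' * ratForm a x < α * b' - α' * b} := by
    simpa only [e, Rat.cast_sub, Rat.cast_mul] using
      (isRatHalfspace_lt (α • a' - α' • a) (α * b' - α' * b)).isRatGenPoly
  have hle : IsRatGenPoly {x : ι → ℝ | α * ratForm a' x - α' * ratForm a x ≤ α * b' - α' * b} := by
    simpa only [e, Rat.cast_sub, Rat.cast_mul] using
      (isRatHalfspace_le (α • a' - α' • a) (α * b' - α' * b)).isRatGenPoly
  rcases h with rfl | rfl <;> rcases h' with rfl | rfl
  · convert hle using 1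
    ext x
    simpa [ratForm_add_smul, ratForm_ratCast, ← hαdef, ← hα'def] using
      exists_add_mul_le_and_le hαr hα'r (ratForm a x) (ratForm a' x) b b'
  -- If at least one halfspace is open, the eliminated inequality is strict.
  all_goals
    convert hlt using 1
    ext x
    simp only [Set.mem_inter_iff, Set.mem_ofPred_eq, ratForm_add_smul, ratForm_ratCast, ← hαdef,
      ← hα'def]
    constructor
    · rintro ⟨s, h, h'⟩
      nlinarith
    · intro h
      obtain ⟨s, h₁, h₂⟩ := exists_add_mul_lt_and_lt hαr hα'r h
      first
        | exact ⟨s, h₁, h₂⟩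
        | exact ⟨s, h₁.le, h₂⟩
        | exact ⟨s, h₁, h₂.le⟩

theorem mem_of_ratForm_lt {a : ι → ℚ} {b : ℚ} {H : Set (ι → ℝ)}
    (h : H = {x | ratForm a x ≤ b} ∨ H = {x | ratForm a x < b}) {x : ι → ℝ}
    (hx : ratForm a x < b) : x ∈ H := by
  rcases h with rfl | rfl
  · exact hx.le
  · exact hx

theorem add_smul_mem_iff_of_ratForm_eq_zero {a : ι → ℚ} {b : ℚ} {H : Set (ι → ℝ)}
    (h : H = {x | ratForm a x ≤ b} ∨ H = {x | ratForm a x < b}) {v : ι → ℝ}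
    (hv : ratForm a v = 0) (x : ι → ℝ) (s : ℝ) : x + s • v ∈ H ↔ x ∈ H := by
  rcases h with rfl | rfl <;> simp [hv]

theorem IsRatHalfspace.isRatGenPoly_exists_add_smul_mem {H : Set (ι → ℝ)} (h : IsRatHalfspace H)
    (v : ι → ℚ) : IsRatGenPoly {x | ∃ s : ℝ, x + s • (fun i => (v i : ℝ)) ∈ H} := by
  have hH := h
  obtain ⟨a, b, h⟩ := h
  rcases lt_trichotomy (∑ i, a i * v i) 0 with hα | hα | hα
  · have hα : ratForm a (fun i => (v i : ℝ)) < 0 := by rw [ratForm_ratCast]; exact_mod_cast hα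
    convert isRatGenPoly_univ (ι := ι) using 1
    refine Set.eq_univ_of_forall fun x => ?_
    obtain ⟨s, hs⟩ := (eventually_atTop_add_mul_lt hα (ratForm a x) b).exists
    exact ⟨s, mem_of_ratForm_lt h (by rwa [ratForm_add_smul])⟩
  · have hα : ratForm a (fun i => (v i : ℝ)) = 0 := by rw [ratForm_ratCast]; exact_mod_cast hα
    simpa only [add_smul_mem_iff_of_ratForm_eq_zero h hα, exists_const, Set.ofPred_mem_eq] using
      hH.isRatGenPoly
  · have hα : 0 < ratForm a (fun i => (v i : ℝ)) := by rw [ratForm_ratCast]; exact_mod_cast hα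
    convert isRatGenPoly_univ (ι := ι) using 1
    refine Set.eq_univ_of_forall fun x => ?_
    obtain ⟨s, hs⟩ := (eventually_atBot_add_mul_lt hα (ratForm a x) b).exists
    exact ⟨s, mem_of_ratForm_lt h (by rwa [ratForm_add_smul])⟩

/-- A form vanishing on v puts no condition on s. Two forms of equal sign on v are both satisfied
far out in one direction, so only opposite signs produce a new inequality. -/
theorem isRatGenPoly_exists_add_smul_mem_inter {H H' : Set (ι → ℝ)} (hH : IsRatHalfspace H)
    (hH' : IsRatHalfspace H') (v : ι → ℚ) :
    IsRatGenPoly {x | ∃ s : ℝ, x + s • (fun i => (v i : ℝ)) ∈ H ∩ H'} := by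
  obtain ⟨a, b, h⟩ := id hH
  obtain ⟨a', b', h'⟩ := id hH'
  have cast_neg {c : ι → ℚ} (hc : ∑ i, c i * v i < 0) : ratForm c (fun i => (v i : ℝ)) < 0 := by
    rw [ratForm_ratCast]; exact_mod_cast hc
  have cast_pos {c : ι → ℚ} (hc : 0 < ∑ i, c i * v i) : 0 < ratForm c (fun i => (v i : ℝ)) := by
    rw [ratForm_ratCast]; exact_mod_cast hc
  have cast_zero {c : ι → ℚ} (hc : ∑ i, c i * v i = 0) : ratForm c (fun i => (v i : ℝ)) = 0 := by
    rw [ratForm_ratCast]; exact_mod_cast hc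
  by_cases h₀ : ∑ i, a i * v i = 0
  · convert hH.isRatGenPoly.inter (hH'.isRatGenPoly_exists_add_smul_mem v) using 1
    ext x
    simp [add_smul_mem_iff_of_ratForm_eq_zero h (cast_zero h₀)]
  by_cases h₀' : ∑ i, a' i * v i = 0
  · convert (hH.isRatGenPoly_exists_add_smul_mem v).inter hH'.isRatGenPoly using 1
    ext x
    simp [add_smul_mem_iff_of_ratForm_eq_zero h' (cast_zero h₀')]
  rcases lt_or_gt_of_ne h₀ with hα | hα <;> rcases lt_or_gt_of_ne h₀' with hα' | hα'
  · convert isRatGenPoly_univ (ι := ι) using 1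
    refine Set.eq_univ_of_forall fun x => ?_
    obtain ⟨s, hs, hs'⟩ := ((eventually_atTop_add_mul_lt (cast_neg hα) (ratForm a x) b).and
      (eventually_atTop_add_mul_lt (cast_neg hα') (ratForm a' x) b')).exists
    exact ⟨s, mem_of_ratForm_lt h (by rwa [ratForm_add_smul]),
      mem_of_ratForm_lt h' (by rwa [ratForm_add_smul])⟩
  · rw [Set.inter_comm]
    exact isRatGenPoly_exists_add_smul_mem_of_pos_of_neg h' h v hα' hα
  · exact isRatGenPoly_exists_add_smul_mem_of_pos_of_neg h h' v hα hα'
  · convert isRatGenPoly_univ (ι := ι) using 1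
    refine Set.eq_univ_of_forall fun x => ?_
    obtain ⟨s, hs, hs'⟩ := ((eventually_atBot_add_mul_lt (cast_pos hα) (ratForm a x) b).and
      (eventually_atBot_add_mul_lt (cast_pos hα') (ratForm a' x) b')).exists
    exact ⟨s, mem_of_ratForm_lt h (by rwa [ratForm_add_smul]),
      mem_of_ratForm_lt h' (by rwa [ratForm_add_smul])⟩

/-- Helly's theorem on the line: pairwise intersecting finitely many convex sets have a common
point. -/
theorem exists_forall_mem_of_convex_of_pairwise {σ : Type*} [Finite σ] {F : σ → Set ℝ}
    (hF : ∀ i, Convex ℝ (F i)) (h : ∀ i j, (F i ∩ F j).Nonempty) : ∃ s, ∀ i, s ∈ F i := by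
  classical
  cases nonempty_fintype σ
  suffices (⋂ i ∈ (Finset.univ : Finset σ), F i).Nonempty by
    obtain ⟨s, hs⟩ := this
    exact ⟨s, by simpa using hs⟩
  refine Convex.helly_theorem' (𝕜 := ℝ) (fun i _ => hF i) fun I _ hI => ?_
  rw [Module.finrank_self] at hI
  rcases Finset.eq_empty_or_nonempty I with rfl | ⟨i, hi⟩
  · simp
  -- In dimension one, Helly's theorem only tests subfamilies of at most two sets.
  have : ∃ j, I ⊆ {i, j} := by
    by_cases hj : ∃ j ∈ I, j ≠ i
    · obtain ⟨j, hj, hne⟩ := hj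
      refine ⟨j, (Finset.eq_of_subset_of_card_le (s := {i, j}) ?_ ?_).ge⟩
      · simp [Finset.insert_subset_iff, hi, hj]
      · rw [Finset.card_pair hne.symm]
        exact hI
    · push Not at hj
      exact ⟨i, fun j hjI => by simp [hj j hjI]⟩
  obtain ⟨j, hj⟩ := this
  obtain ⟨s, hs, hs'⟩ := h i j
  refine ⟨s, Set.mem_iInter₂.2 fun k hk => ?_⟩
  rcases Finset.mem_insert.1 (hj hk) with rfl | hk
  · exact hs
  · rw [Finset.mem_singleton.1 hk]
    exact hs'

/-- Fourier–Motzkin elimination along a rational direction. -/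
theorem IsRatGenPoly.exists_add_smul_mem {Q : Set (ι → ℝ)} (hQ : IsRatGenPoly Q) (v : ι → ℚ) :
    IsRatGenPoly {x | ∃ s : ℝ, x + s • (fun i => (v i : ℝ)) ∈ Q} := by
  obtain ⟨𝓗, hfin, hH, rfl⟩ := hQ
  have := hfin.to_subtype
  -- For fixed x each halfspace allows a convex set of s, so by Helly it suffices to eliminate s
  -- from pairs.
  convert IsRatGenPoly.iInter fun p : 𝓗 × 𝓗 =>
    isRatGenPoly_exists_add_smul_mem_inter (hH p.1 p.1.2) (hH p.2 p.2.2) v using 1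
  ext x
  simp only [Set.mem_ofPred_eq, Set.mem_iInter]
  constructor
  · rintro ⟨s, hs⟩ p
    exact ⟨s, hs _ p.1.2, hs _ p.2.2⟩
  · intro h
    obtain ⟨s, hs⟩ := exists_forall_mem_of_convex_of_pairwise
      (F := fun H : 𝓗 => {s : ℝ | x + s • (fun i => (v i : ℝ)) ∈ H.1})
      (fun H => by
        have e : {s : ℝ | x + s • (fun i => (v i : ℝ)) ∈ H.1} =
            (AffineMap.lineMap x (x + fun i => (v i : ℝ)) : ℝ →ᵃ[ℝ] (ι → ℝ)) ⁻¹' H.1 := by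
          ext s
          simp [AffineMap.lineMap_apply, add_comm]
        rw [e]
        exact (hH H H.2).convex.affine_preimage _)
      (fun H H' => h (H, H'))
    exact ⟨s, fun H hmem => hs ⟨H, hmem⟩⟩

theorem IsRatGenPoly.exists_add_sum_smul_mem {σ : Type*} (t : Finset σ) {Q : Set (ι → ℝ)}
    (hQ : IsRatGenPoly Q) (v : σ → ι → ℚ) :
    IsRatGenPoly {x | ∃ s : σ → ℝ, x + ∑ j ∈ t, s j • (fun i => (v j i : ℝ)) ∈ Q} := by
  classical
  induction t using Finset.induction_on generalizing Q with
  | empty => simpa using hQ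
  | insert j t hj ih =>
    convert ih (hQ.exists_add_smul_mem (v j)) using 1
    ext x
    simp only [Set.mem_ofPred_eq, Finset.sum_insert hj]
    constructor
    · rintro ⟨s, hs⟩
      exact ⟨s, s j, by rwa [add_assoc, add_comm (∑ _ ∈ _, _)]⟩
    · rintro ⟨s, u, hs⟩
      refine ⟨Function.update s j u, ?_⟩
      rw [Finset.sum_congr rfl fun k hk => by
        rw [Function.update_of_ne (ne_of_mem_of_not_mem hk hj)]]
      rwa [Function.update_self, add_comm (u • _), ← add_assoc]

/-- Rational linear images of rational generalized polyhedra are such polyhedra. -/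
theorem IsRatGenPoly.image [Fintype κ] {P : Set (ι → ℝ)} (hP : IsRatGenPoly P)
    (L : Matrix κ ι ℚ) : IsRatGenPoly (ratMap L '' P) := by
  classical
  -- A point y is in the image iff (y, 0) can be moved into {0} × P along the directions (-L eᵢ,
  -- eᵢ).
  have hQ : IsRatGenPoly {z : κ ⊕ ι → ℝ | z ∘ Sum.inr ∈ P ∧ ∀ k, z (Sum.inl k) = 0} := by
    convert (isRatGenPoly_preimage_comp hP Sum.inr).inter
      (IsRatGenPoly.iInter fun k : κ => isRatGenPoly_coord_eq (Sum.inl k : κ ⊕ ι) 0) using 1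
    ext z
    simp
  have := (hQ.exists_add_sum_smul_mem Finset.univ
    fun i : ι => Sum.elim (fun k => -L k i) (Pi.single i 1)).preimage
    (fun z : κ ⊕ ι => Sum.elim (fun k => Pi.single k 1) (fun _ => 0) z : Matrix (κ ⊕ ι) κ ℚ)
  convert this using 1
  ext y
  have e₁ (k : κ) : ratMap (fun z : κ ⊕ ι => Sum.elim (fun k => Pi.single k 1)
      (fun _ => 0) z : Matrix (κ ⊕ ι) κ ℚ) y (Sum.inl k) = y k := ratForm_single k y
  have e₂ (i : ι) : ratMap (fun z : κ ⊕ ι => Sum.elim (fun k => Pi.single k 1)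
      (fun _ => 0) z : Matrix (κ ⊕ ι) κ ℚ) y (Sum.inr i) = 0 := ratForm_zero y
  have e₃ (s : ι → ℝ) : (fun i => ∑ j, s j * ((Pi.single j 1 : ι → ℚ) i : ℝ)) = s := by
    ext i
    rw [Finset.sum_eq_single i] <;> simp +contextual
  simp only [Set.mem_image, Set.mem_preimage, Set.mem_ofPred_eq, Pi.add_apply, e₁,
    Finset.sum_apply, Pi.smul_apply, smul_eq_mul, Sum.elim_inl, Function.comp_def, e₂,
    Sum.elim_inr, zero_add, e₃]
  refine exists_congr fun s => and_congr_right fun _ => ?_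
  rw [funext_iff]
  refine forall_congr' fun k => ?_
  rw [ratMap_apply]
  have e₄ : ∑ i, s i * ((-L k i : ℚ) : ℝ) = -∑ i, (L k i : ℝ) * s i := by
    rw [← Finset.sum_neg_distrib]
    refine Finset.sum_congr rfl fun i _ => ?_
    push_cast
    ring
  constructor
  · intro h
    exact (congrArg (y k + ·) e₄).trans (by simp [h])
  · intro h
    have : y k + -∑ i, (L k i : ℝ) * s i = 0 := (congrArg (y k + ·) e₄).symm.trans h
    linarith

end Projection

end GenMILP

namespace GenMILP

/-! ### Integer generators of rational polyhedral cones -/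

section Cones

open PointedCone

/-- The cone generated by `S`, cut by a halfspace `f ≤ 0`, is generated by the generators in that
halfspace and by combinations of two generators on different sides (double description). -/
theorem mem_hull_of_mem_hull_of_nonpos {E : Type*} [AddCommGroup E] [Module ℝ E] (f : E →ₗ[ℝ] ℝ)
    {S T : Set E} (hT₁ : ∀ g ∈ S, f g ≤ 0 → g ∈ T)
    (hT₂ : ∀ g ∈ S, ∀ h ∈ S, 0 < f g → f h < 0 → f g • h - f h • g ∈ hull ℝ T)
    {x : E} (hx : x ∈ hull ℝ S) (hf : f x ≤ 0) : x ∈ hull ℝ T := by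
  have hS : S = {g ∈ S | 0 < f g} ∪ {g ∈ S | f g ≤ 0} := by
    ext g
    simp only [Set.mem_union, Set.mem_ofPred_eq, ← and_or_left]
    exact ⟨fun h => ⟨h, lt_or_ge 0 (f g)⟩, And.left⟩
  rw [hS, hull, Submodule.span_union] at hx
  obtain ⟨p, hp, m, hm, rfl⟩ := Submodule.mem_sup.1 hx
  have hmT {m : E} (hm : m ∈ hull ℝ {g ∈ S | f g ≤ 0}) : m ∈ hull ℝ T :=
    Submodule.span_mono (fun g hg => hT₁ g hg.1 hg.2) hm
  -- The expression is bilinear in p and m, so it is enough to check generators.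
  have bilin {p m : E} (hp : p ∈ hull ℝ {g ∈ S | 0 < f g}) (hm : m ∈ hull ℝ {g ∈ S | f g ≤ 0}) :
      f p • m - f m • p ∈ hull ℝ T := by
    induction hp using Submodule.span_induction with
    | zero => simp
    | add p p' _ _ h h' =>
      convert add_mem h h' using 1
      rw [map_add]
      module
    | smul c p _ h =>
      convert Submodule.smul_mem _ c h using 1
      change f ((c : ℝ) • p) • m - f m • (c : ℝ) • p = (c : ℝ) • (f p • m - f m • p)
      rw [map_smul, smul_eq_mul]
      module
    | mem p hp =>
      induction hm using Submodule.span_induction with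
      | zero => simp
      | add m m' _ _ h h' =>
        convert add_mem h h' using 1
        rw [map_add]
        module
      | smul c m _ h =>
        convert Submodule.smul_mem _ c h using 1
        change f p • (c : ℝ) • m - f ((c : ℝ) • m) • p = (c : ℝ) • (f p • m - f m • p)
        rw [map_smul, smul_eq_mul]
        module
      | mem m hm =>
        rcases hm.2.lt_or_eq with hlt | heq
        · exact hT₂ p hp.1 m hm.1 hp.2 hlt
        · rw [heq, zero_smul, sub_zero]
          exact PointedCone.smul_mem _ hp.2.le (subset_hull (hT₁ m hm.1 hm.2))
  -- This settles the case 0 ≤ f m: there f p = 0, which forces p = 0.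
  have hfp {p : E} (hp : p ∈ hull ℝ {g ∈ S | 0 < f g}) : 0 ≤ f p ∧ (f p = 0 → p = 0) := by
    induction hp using Submodule.span_induction with
    | zero => simp
    | mem p hp => exact ⟨hp.2.le, fun h => absurd h hp.2.ne'⟩
    | add p p' _ _ h h' =>
      rw [map_add]
      refine ⟨add_nonneg h.1 h'.1, fun h0 => ?_⟩
      rw [h.2 (by linarith [h.1, h'.1]), h'.2 (by linarith [h.1, h'.1]), add_zero]
    | smul c p _ h =>
      change 0 ≤ f ((c : ℝ) • p) ∧ (f ((c : ℝ) • p) = 0 → (c : ℝ) • p = 0)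
      rw [map_smul, smul_eq_mul]
      refine ⟨mul_nonneg c.2 h.1, fun h0 => ?_⟩
      rcases mul_eq_zero.1 h0 with h0 | h0
      · rw [h0, zero_smul]
      · rw [h.2 h0, smul_zero]
  rw [map_add] at hf
  have hp' := hfp hp
  by_cases hm0 : 0 ≤ f m
  · rw [hp'.2 (by linarith [hp'.1]), zero_add]
    exact hmT hm
  · push Not at hm0
    have hm0' : f m ≠ 0 := hm0.ne
    -- Both coefficients are nonnegative, since f m < 0 and f p + f m ≤ 0.
    have e : p + m = (-f m)⁻¹ • (f p • m - f m • p) + ((f p + f m) / f m) • m := by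
      match_scalars <;> field_simp
      ring
    rw [e]
    exact add_mem (PointedCone.smul_mem _ (inv_nonneg.2 (by linarith)) (bilin hp hm))
      (PointedCone.smul_mem _ (div_nonneg_of_nonpos hf hm0.le) (hmT hm))

variable {ι : Type}

/-- The real vector with given integer coordinates. -/
def intVec (g : ι → ℤ) : ι → ℝ := fun i => (g i : ℝ)

@[simp] theorem intVec_apply (g : ι → ℤ) (i : ι) : intVec g i = (g i : ℝ) := rfl

variable [Fintype ι]

theorem mem_hull_integer_generators [DecidableEq ι] (x : ι → ℝ) :
    x ∈ hull ℝ (intVec '' (((Finset.univ.image fun i : ι => (Pi.single i 1 : ι → ℤ)) ∪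
      Finset.univ.image fun i : ι => (-Pi.single i 1 : ι → ℤ) : Finset (ι → ℤ)) :
        Set (ι → ℤ))) := by
  rw [pi_eq_sum_univ x]
  refine sum_mem fun i _ => ?_
  have e : (fun j => if i = j then (1 : ℝ) else 0) = intVec (Pi.single i 1) := by
    ext j
    by_cases h : i = j
    · subst h
      simp
    · simp [h, Ne.symm h]
  rw [e]
  rcases le_total 0 (x i) with h | h
  · exact PointedCone.smul_mem _ h (subset_hull ⟨_, by simp, rfl⟩)
  · rw [show x i • intVec (Pi.single i (1 : ℤ)) = (-x i) • intVec (-Pi.single i (1 : ℤ)) by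
      ext j; simp]
    exact PointedCone.smul_mem _ (by linarith) (subset_hull ⟨_, by simp, rfl⟩)

theorem exists_pos_mul_eq_intCast (a : ι → ℚ) :
    ∃ (N : ℕ) (a' : ι → ℤ), 0 < N ∧ ∀ i, (a' i : ℚ) = N * a i := by
  obtain ⟨b, hb⟩ := IsLocalization.exist_integer_multiples_of_finite (nonZeroDivisors ℤ) a
  choose c hc using hb
  have hb0 : (b : ℤ) ≠ 0 := nonZeroDivisors.ne_zero b.2
  -- The common denominator b may be negative; its sign is moved into the numerators.
  refine ⟨(b : ℤ).natAbs, fun i => (b : ℤ).sign * c i, Int.natAbs_pos.2 hb0, fun i => ?_⟩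
  have hi : (c i : ℚ) = (b : ℤ) * a i := by simpa using hc i
  have hs : (((b : ℤ).sign * (b : ℤ) : ℤ) : ℚ) = (((b : ℤ).natAbs : ℤ) : ℚ) := by
    rw [Int.sign_mul_self_eq_natAbs]
  rw [Int.cast_mul, hi, ← mul_assoc, ← Int.cast_mul, hs, Int.cast_natCast]

/-- Rational polyhedral cones are generated by finitely many integer vectors. -/
theorem exists_integer_generators (𝒜 : Finset (ι → ℚ)) :
    ∃ G : Finset (ι → ℤ), (∀ g ∈ G, ∀ a ∈ 𝒜, ratForm a (intVec g) ≤ 0) ∧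
      ∀ x : ι → ℝ, (∀ a ∈ 𝒜, ratForm a x ≤ 0) → x ∈ hull ℝ (intVec '' (G : Set (ι → ℤ))) := by
  classical
  induction 𝒜 using Finset.induction_on with
  | empty => exact ⟨_, by simp, fun x _ => mem_hull_integer_generators x⟩
  | insert a 𝒜 _ ih =>
    obtain ⟨G, hG, hx⟩ := ih
    obtain ⟨N, a', hN, ha'⟩ := exists_pos_mul_eq_intCast a
    have hNr : (0 : ℝ) < N := by exact_mod_cast hN
    -- Using N times the form a keeps the combinations of two generators integral.
    let d (g : ι → ℤ) : ℤ := ∑ i, a' i * g i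
    have hd (g : ι → ℤ) : (d g : ℝ) = N * ratForm a (intVec g) := by
      simp only [d, ratForm_apply, Int.cast_sum, Int.cast_mul, Finset.mul_sum, intVec_apply]
      refine Finset.sum_congr rfl fun i _ => ?_
      have : (a' i : ℝ) = N * a i := by exact_mod_cast congrArg (Rat.cast (K := ℝ)) (ha' i)
      rw [this, mul_assoc]
    have hcomb (g h : ι → ℤ) : intVec (d g • h - d h • g) =
        (N : ℝ) • (ratForm a (intVec g) • intVec h - ratForm a (intVec h) • intVec g) := by
      ext i
      simp [hd]
      ring
    let G' := {g ∈ G | ratForm a (intVec g) ≤ 0} ∪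
      (({g ∈ G | 0 < ratForm a (intVec g)} ×ˢ {h ∈ G | ratForm a (intVec h) < 0}).image
        fun p => d p.1 • p.2 - d p.2 • p.1)
    refine ⟨G', ?_, ?_⟩
    · intro g hg b hb
      rcases Finset.mem_union.1 hg with hg | hg
      · obtain ⟨hgG, hga⟩ := Finset.mem_filter.1 hg
        rcases Finset.mem_insert.1 hb with rfl | hb
        · exact hga
        · exact hG g hgG b hb
      · obtain ⟨⟨g, h⟩, hgh, rfl⟩ := Finset.mem_image.1 hg
        obtain ⟨hg, hh⟩ := Finset.mem_product.1 hgh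
        obtain ⟨hgG, hga⟩ := Finset.mem_filter.1 hg
        obtain ⟨hhG, hha⟩ := Finset.mem_filter.1 hh
        simp only at hgG hga hhG hha ⊢
        rw [hcomb, map_smul, smul_eq_mul, map_sub, map_smul, map_smul, smul_eq_mul, smul_eq_mul]
        refine mul_nonpos_of_nonneg_of_nonpos hNr.le ?_
        rcases Finset.mem_insert.1 hb with rfl | hb
        -- The new generator lies on the hyperplane where a vanishes.
        · exact (by ring : _ = (0 : ℝ)).le
        · have h₁ := mul_nonpos_of_nonneg_of_nonpos hga.le (hG h hhG b hb)
          have h₂ := mul_nonneg_of_nonpos_of_nonpos hha.le (hG g hgG b hb)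
          linarith
    · intro x hxa
      refine mem_hull_of_mem_hull_of_nonpos (ratForm a) ?_ ?_
        (hx x fun b hb => hxa b (Finset.mem_insert_of_mem hb))
        (hxa a (Finset.mem_insert_self _ _))
      · rintro _ ⟨g, hg, rfl⟩ hga
        exact ⟨g, Finset.mem_union_left _ (Finset.mem_filter.2 ⟨hg, hga⟩), rfl⟩
      · rintro _ ⟨g, hg, rfl⟩ _ ⟨h, hh, rfl⟩ hga hha
        have : ratForm a (intVec g) • intVec h - ratForm a (intVec h) • intVec g =
            (N : ℝ)⁻¹ • intVec (d g • h - d h • g) := by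
          rw [hcomb, inv_smul_smul₀ hNr.ne']
        rw [this]
        exact PointedCone.smul_mem _ (inv_nonneg.2 hNr.le) (subset_hull ⟨_,
          Finset.mem_union_right _ (Finset.mem_image.2 ⟨(g, h), Finset.mem_product.2
            ⟨Finset.mem_filter.2 ⟨hg, hga⟩, Finset.mem_filter.2 ⟨hh, hha⟩⟩, rfl⟩), rfl⟩)

end Cones

end GenMILP

namespace GenMILP

/-! ### Bounded part plus integer recession directions -/

section Decomposition

variable {ι : Type} [Fintype ι]

/-- The coefficients of the homogenization `∑ i, a i * x i - b * t` of `∑ i, a i * x i - b`. -/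
def homogenize (a : ι → ℚ) (b : ℚ) : Option ι → ℚ := fun o => o.elim (-b) a

theorem ratForm_homogenize (a : ι → ℚ) (b : ℚ) (y : Option ι → ℝ) :
    ratForm (homogenize a b) y = ratForm a (fun i => y (some i)) - b * y none := by
  simp only [ratForm_apply, homogenize, Fintype.sum_option, Option.elim_none, Option.elim_some,
    Rat.cast_neg]
  ring

theorem IsRatHalfspace.exists_eq {H : Set (ι → ℝ)} (h : IsRatHalfspace H) :
    ∃ p : (ι → ℚ) × ℚ, H = {x | ratForm p.1 x ≤ p.2} ∨ H = {x | ratForm p.1 x < p.2} := by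
  obtain ⟨a, b, h⟩ := h
  exact ⟨(a, b), h⟩

/-- Splitting off integer parts: `m` is a natural number, and the remainder lies in `[0, 1]` and
vanishes only if the given number does. -/
theorem exists_nat_sub_mem_Icc {c : ℝ} (hc : 0 ≤ c) :
    ∃ m : ℕ, 0 ≤ c - m ∧ c - m ≤ 1 ∧ (c - m = 0 → c = 0) := by
  rcases hc.eq_or_lt with rfl | hc
  · exact ⟨0, by simp, by simp, by simp⟩
  -- Taking ⌈c⌉ - 1 instead of the floor keeps the remainder in (0, 1]; its positivity is what
  -- preserves strict inequalities.
  · obtain ⟨k, hk⟩ := Nat.exists_eq_succ_of_ne_zero (Nat.ceil_pos.2 hc).ne'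
    have h₁ := Nat.ceil_lt_add_one hc.le
    have h₂ := Nat.le_ceil c
    rw [hk, Nat.cast_succ] at h₁ h₂
    exact ⟨k, by linarith, by linarith, fun h => by linarith⟩

/-- Every point of a rational generalized polyhedron is the sum of a point in a bounded part of
it and a nonnegative integer combination of finitely many integer recession directions. -/
theorem IsRatGenPoly.exists_integer_recession {P : Set (ι → ℝ)} (hP : IsRatGenPoly P) :
    ∃ (σ : Type) (_ : Fintype σ) (r : σ → ι → ℤ) (K : ℕ),
      (∀ x ∈ P, ∀ c : σ → ℕ, x + ∑ g, (c g : ℝ) • intVec (r g) ∈ P) ∧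
      ∀ x ∈ P, ∃ q ∈ P, ∃ c : σ → ℕ, x = q + ∑ g, (c g : ℝ) • intVec (r g) ∧
        ∀ i, |q i| ≤ K := by
  classical
  obtain ⟨𝓗, hfin, hH, rfl⟩ := hP
  have := hfin.fintype
  choose p hp using fun H : 𝓗 => (hH H H.2).exists_eq
  -- The first form encodes t ≥ 0; the others homogenize all the inequalities, strict ones relaxed
  -- to ≤.
  let 𝒜 : Finset (Option ι → ℚ) :=
    insert (homogenize 0 1) (Finset.univ.image fun H => homogenize (p H).1 (p H).2)
  obtain ⟨G, hG, hspan⟩ := exists_integer_generators 𝒜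
  have hG0 (g : G) : 0 ≤ g.1 none := by
    have := hG g g.2 _ (Finset.mem_insert_self _ _)
    rw [ratForm_homogenize, ratForm_zero] at this
    have h : (0 : ℝ) ≤ g.1 none := by simpa using this
    exact_mod_cast h
  have hGH (g : G) (H : 𝓗) : ratForm (homogenize (p H).1 (p H).2) (intVec g.1) ≤ 0 :=
    hG g g.2 _ (Finset.mem_insert_of_mem (Finset.mem_image_of_mem _ (Finset.mem_univ H)))
  -- Generators at height t = 0 are recession directions; the rest get the zero vector so that one
  -- index type serves.
  let r (g : G) (i : ι) : ℤ := if g.1 none = 0 then g.1 (some i) else 0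
  have hr (g : G) (H : 𝓗) : ratForm (p H).1 (intVec (r g)) ≤ 0 := by
    by_cases h : g.1 none = 0
    · have := hGH g H
      rw [ratForm_homogenize] at this
      have e : intVec (r g) = fun i => intVec g.1 (some i) := by ext i; simp [r, h]
      rw [e]
      simpa [h] using this
    · have e : intVec (r g) = 0 := by ext i; simp [r, h]
      rw [e, map_zero]
  refine ⟨G, inferInstance, r, ∑ g : G, ∑ i, (g.1 (some i)).natAbs, ?_, ?_⟩
  · intro x hx c H hmem
    have hxH := hx H hmem
    have : ratForm (p ⟨H, hmem⟩).1 (∑ g, (c g : ℝ) • intVec (r g)) ≤ 0 := by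
      rw [map_sum]
      refine Finset.sum_nonpos fun g _ => ?_
      rw [map_smul]
      exact mul_nonpos_of_nonneg_of_nonpos (Nat.cast_nonneg _) (hr g ⟨H, hmem⟩)
    rcases hp ⟨H, hmem⟩ with h | h <;> simp only at h <;> rw [h] at hxH ⊢
    · rw [Set.mem_ofPred_eq, map_add]
      linarith [show ratForm (p ⟨H, hmem⟩).1 x ≤ (p ⟨H, hmem⟩).2 from hxH]
    · rw [Set.mem_ofPred_eq, map_add]
      linarith [show ratForm (p ⟨H, hmem⟩).1 x < (p ⟨H, hmem⟩).2 from hxH]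
  · intro x hx
    let y : Option ι → ℝ := fun o => o.elim 1 x
    have hy : ∀ a ∈ 𝒜, ratForm a y ≤ 0 := by
      intro a ha
      rcases Finset.mem_insert.1 ha with rfl | ha
      · rw [ratForm_homogenize, ratForm_zero]
        simp [y]
      · obtain ⟨H, -, rfl⟩ := Finset.mem_image.1 ha
        rw [ratForm_homogenize]
        have hxH := hx H.1 H.2
        simp only [y, Option.elim_none, Option.elim_some, mul_one, sub_nonpos]
        rcases hp H with h | h <;> rw [h] at hxH
        · exact hxH
        · exact le_of_lt hxH
    obtain ⟨l, hl0, hl⟩ : ∃ l : G → ℝ, (∀ g, 0 ≤ l g) ∧ ∑ g : G, l g • intVec g.1 = y := by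
      obtain ⟨l, hl⟩ := (Submodule.mem_span_image_finset_iff_exists_fun _).1 (hspan y hy)
      exact ⟨fun g => l g, fun g => (l g).2, hl⟩
    have hnone : ∑ g : G, l g * g.1 none = 1 := by
      simpa [y] using congrFun hl none
    have hsome (i : ι) : ∑ g : G, l g * g.1 (some i) = x i := by
      simpa [y] using congrFun hl (some i)
    -- The heights are nonnegative integers and their weighted sum is 1, so a nonzero height forces
    -- a weight at most 1.
    have hle (g : G) (hg : g.1 none ≠ 0) : l g ≤ 1 := by
      have h1 : (1 : ℝ) ≤ g.1 none := by exact_mod_cast lt_of_le_of_ne (hG0 g) (Ne.symm hg)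
      have h2 : l g * g.1 none ≤ 1 := by
        rw [← hnone]
        exact Finset.single_le_sum (f := fun g : G => l g * g.1 none)
          (fun g _ => mul_nonneg (hl0 g) (by exact_mod_cast hG0 g)) (Finset.mem_univ g)
      nlinarith [hl0 g]
    have hm (g : G) : ∃ m : ℕ, 0 ≤ l g - m ∧ l g - m ≤ 1 ∧
        (l g - m = 0 → l g = 0) ∧ (g.1 none ≠ 0 → m = 0) := by
      by_cases hg : g.1 none = 0
      · obtain ⟨m, h₁, h₂, h₃⟩ := exists_nat_sub_mem_Icc (hl0 g)
        exact ⟨m, h₁, h₂, h₃, fun h => absurd hg h⟩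
      · exact ⟨0, by simpa using hl0 g, by simpa using hle g hg, by simp, fun _ => rfl⟩
    choose m hm0 hm1 hmz hmn using hm
    let q (i : ι) : ℝ := ∑ g : G, (l g - m g) * g.1 (some i)
    have hmr (g : G) (i : ι) : (m g : ℝ) * g.1 (some i) = m g * (r g i : ℤ) := by
      by_cases hg : g.1 none = 0
      · simp [r, hg]
      · simp [hmn g hg]
    have hmnone (g : G) : (m g : ℝ) * g.1 none = 0 := by
      by_cases hg : g.1 none = 0
      · simp [hg]
      · simp [hmn g hg]
    have hqhom : ∑ g : G, (l g - m g) • intVec g.1 = fun o => o.elim 1 q := by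
      ext o
      rcases o with - | i
      · simp only [Finset.sum_apply, Pi.smul_apply, smul_eq_mul, intVec_apply, sub_mul, hmnone,
          sub_zero, Option.elim_none, hnone]
      · simp only [Finset.sum_apply, Pi.smul_apply, smul_eq_mul, intVec_apply, Option.elim_some, q]
    refine ⟨q, ?_, m, ?_, ?_⟩
    · intro H hmem
      have hxH := hx H hmem
      set f := ratForm (homogenize (p ⟨H, hmem⟩).1 (p ⟨H, hmem⟩).2) with hf
      have hterm (g : G) : (l g - m g) * f (intVec g.1) ≤ 0 :=
        mul_nonpos_of_nonneg_of_nonpos (hm0 g) (hGH g ⟨H, hmem⟩)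
      have hfq : f (fun o => o.elim 1 q) = ∑ g : G, (l g - m g) * f (intVec g.1) := by
        rw [← hqhom, map_sum]
        simp
      have hfq' : f (fun o => o.elim 1 q) = ratForm (p ⟨H, hmem⟩).1 q - (p ⟨H, hmem⟩).2 := by
        rw [hf, ratForm_homogenize]
        simp
      have hfx : f y = ratForm (p ⟨H, hmem⟩).1 x - (p ⟨H, hmem⟩).2 := by
        rw [hf, ratForm_homogenize]
        simp [y]
      have hfy : f y = ∑ g : G, l g * f (intVec g.1) := by
        rw [← hl, map_sum]
        simp
      have hnonpos : ∑ g : G, (l g - m g) * f (intVec g.1) ≤ 0 :=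
        Finset.sum_nonpos fun g _ => hterm g
      rcases hp ⟨H, hmem⟩ with h | h <;> simp only at h <;> rw [h] at hxH ⊢
      · show ratForm (p ⟨H, hmem⟩).1 q ≤ (p ⟨H, hmem⟩).2
        linarith
      · show ratForm (p ⟨H, hmem⟩).1 q < (p ⟨H, hmem⟩).2
        have hxH : ratForm (p ⟨H, hmem⟩).1 x < (p ⟨H, hmem⟩).2 := hxH
        -- Equality at q makes every term vanish. A vanishing remainder means a vanishing original
        -- weight, so equality would hold at x too.
        by_contra hcon
        have hzero : ∑ g : G, (l g - m g) * f (intVec g.1) = 0 := by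
          linarith
        rw [Finset.sum_eq_zero_iff_of_nonpos fun g _ => hterm g] at hzero
        have : f y = 0 := by
          rw [hfy]
          refine Finset.sum_eq_zero fun g hg => ?_
          rcases mul_eq_zero.1 (hzero g hg) with h0 | h0
          · rw [hmz g h0, zero_mul]
          · rw [h0, mul_zero]
        linarith
    · ext i
      simp only [Pi.add_apply, Finset.sum_apply, Pi.smul_apply, smul_eq_mul, intVec_apply, q,
        ← hmr, ← hsome i]
      rw [← Finset.sum_add_distrib]
      exact Finset.sum_congr rfl fun g _ => by ring
    · intro i
      push_cast
      refine (Finset.abs_sum_le_sum_abs _ _).trans (Finset.sum_le_sum fun g _ => ?_)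
      have h₁ : |(l g - m g) * g.1 (some i)| ≤ |(g.1 (some i) : ℝ)| := by
        rw [abs_mul, abs_of_nonneg (hm0 g)]
        exact mul_le_of_le_one_left (abs_nonneg _) (hm1 g)
      refine h₁.trans ?_
      have h₂ := Finset.single_le_sum (f := fun i => ((g.1 (some i)).natAbs : ℝ))
        (fun _ _ => Nat.cast_nonneg _) (Finset.mem_univ i)
      simpa [Nat.cast_natAbs] using h₂

/-- A rational generalized mixed-integer set is a finite union of sums of bounded rational
generalized polyhedra and a common finitely generated monoid of integer vectors. -/
theorem IsRatGenPoly.exists_mixedInteger_eq_iUnion {P : Set (ι → ℝ)} (hP : IsRatGenPoly P)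
    (I : Set ι) :
    ∃ (σ τ : Type) (_ : Fintype σ) (_ : Finite τ) (r : σ → ι → ℤ) (D : τ → Set (ι → ℝ)),
      (∀ t, IsRatGenPoly (D t) ∧ Bornology.IsBounded (D t)) ∧
      {x | x ∈ P ∧ ∀ i ∈ I, ∃ z : ℤ, x i = (z : ℝ)} =
        ⋃ t, (D t + {y | ∃ c : σ → ℕ, y = ∑ g, (c g : ℝ) • intVec (r g)}) := by
  classical
  obtain ⟨σ, _, r, K, hrec, hdec⟩ := hP.exists_integer_recession
  -- The index z prescribes the values on `I` of the bounded part within the box [-K, K]; off `I` it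
  -- is irrelevant.
  refine ⟨σ, ι → Set.Icc (-K : ℤ) K, inferInstance, inferInstance, r,
    fun z => P ∩ ((⋂ i, ({x | x i ≤ ((K : ℚ) : ℝ)} ∩ {x | (((-K : ℚ)) : ℝ) ≤ x i})) ∩
      ⋂ i : I, {x | x i = (((z i : ℤ) : ℚ) : ℝ)}), fun z => ⟨?_, ?_⟩, ?_⟩
  · exact hP.inter ((IsRatGenPoly.iInter fun i => (isRatGenPoly_coord_le i _).inter
      (isRatGenPoly_coord_ge i _)).inter (IsRatGenPoly.iInter fun i => isRatGenPoly_coord_eq _ _))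
  · refine (Metric.isBounded_Icc (fun _ : ι => (-K : ℝ)) fun _ => (K : ℝ)).subset ?_
    rintro x ⟨-, hx, -⟩
    rw [Set.mem_iInter] at hx
    exact ⟨fun i => by simpa using (hx i).2, fun i => by simpa using (hx i).1⟩
  · ext x
    simp only [Set.mem_iUnion, Set.mem_add]
    constructor
    · rintro ⟨hxP, hxI⟩
      obtain ⟨q, hqP, c, hx, hqK⟩ := hdec x hxP
      have hz (i : ι) : ∃ z : Set.Icc (-K : ℤ) K, i ∈ I → q i = ((z : ℤ) : ℝ) := by
        by_cases hi : i ∈ I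
        · obtain ⟨z, hz⟩ := hxI i hi
          have hq : q i = ((z - ∑ g, (c g : ℤ) * r g i : ℤ) : ℝ) := by
            have := congrFun hx i
            simp only [Pi.add_apply, Finset.sum_apply, Pi.smul_apply, smul_eq_mul,
              intVec_apply] at this
            push_cast
            linarith
          have hK := abs_le.1 (hqK i)
          rw [hq] at hK
          exact ⟨⟨_, by exact_mod_cast hK.1, by exact_mod_cast hK.2⟩, fun _ => hq⟩
        · exact ⟨⟨0, by simp⟩, fun h => absurd h hi⟩
      choose z hz using hz
      refine ⟨z, q, ⟨hqP, Set.mem_iInter.2 fun i => ?_, Set.mem_iInter.2 fun i => ?_⟩, _,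
        ⟨c, rfl⟩, hx.symm⟩
      · have hK := abs_le.1 (hqK i)
        exact ⟨by simpa using hK.2, by simpa using hK.1⟩
      · simpa using hz i i.2
    · rintro ⟨z, q, ⟨hqP, -, hqz⟩, _, ⟨c, rfl⟩, rfl⟩
      refine ⟨hrec q hqP c, fun i hi => ?_⟩
      have hqi : q i = (((z i : ℤ) : ℚ) : ℝ) := Set.mem_iInter.1 hqz ⟨i, hi⟩
      refine ⟨z i + ∑ g, (c g : ℤ) * r g i, ?_⟩
      simp [hqi]

end Decomposition

end GenMILP

namespace GenMILP

/-! ### Splitting into relatively open pieces -/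

section RelativelyOpen

/-- The affine span of s lies in A, so inside that span s is the trace of the open set O. -/
theorem intrinsicInterior_eq_self_of_eq_inter {V : Type*} [NormedAddCommGroup V] [NormedSpace ℝ V]
    {s O : Set V} {A : AffineSubspace ℝ V} (hO : IsOpen O) (hs : s = (A : Set V) ∩ O) :
    intrinsicInterior ℝ s = s := by
  have hA : affineSpan ℝ s ≤ A := affineSpan_le.2 (hs ▸ Set.inter_subset_left)
  have e : ((↑) ⁻¹' s : Set (affineSpan ℝ s)) = (↑) ⁻¹' O := by
    ext x
    exact ⟨fun hx => (hs.le hx).2, fun hx => hs.ge ⟨hA x.2, hx⟩⟩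
  have hopen : IsOpen ((↑) ⁻¹' s : Set (affineSpan ℝ s)) := by
    rw [e]
    exact hO.preimage continuous_subtype_val
  rw [intrinsicInterior, hopen.interior_eq]
  exact Set.image_preimage_eq_of_subset (by simpa using subset_affineSpan ℝ s)

variable {ι : Type} [Fintype ι]

/-- Rational generalized polyhedra that are relatively open because they are cut out of an affine
subspace by an open set. -/
def IsRatRelOpen (P : Set (ι → ℝ)) : Prop :=
  IsRatGenPoly P ∧ ∃ (A : AffineSubspace ℝ (ι → ℝ)) (O : Set (ι → ℝ)), IsOpen O ∧
    P = (A : Set (ι → ℝ)) ∩ O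

theorem IsRatRelOpen.iInter {σ : Type*} [Finite σ] {P : σ → Set (ι → ℝ)}
    (h : ∀ s, IsRatRelOpen (P s)) : IsRatRelOpen (⋂ s, P s) := by
  refine ⟨IsRatGenPoly.iInter fun s => (h s).1, ?_⟩
  choose A O hO hP using fun s => (h s).2
  refine ⟨⨅ s, A s, ⋂ s, O s, isOpen_iInter_of_finite hO, ?_⟩
  rw [AffineSubspace.coe_iInf, ← Set.iInter_inter_distrib]
  exact Set.iInter_congr hP

theorem isRatRelOpen_lt (a : ι → ℚ) (b : ℚ) : IsRatRelOpen {x | ratForm a x < b} :=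
  ⟨(isRatHalfspace_lt a b).isRatGenPoly, ⊤, {x | ratForm a x < b},
    isOpen_lt (continuous_ratForm a) continuous_const, by simp⟩

theorem isRatRelOpen_eq (a : ι → ℚ) (b : ℚ) : IsRatRelOpen {x | ratForm a x = b} := by
  refine ⟨isRatGenPoly_eq a b,
    (AffineSubspace.mk' (b : ℝ) ⊥).comap (ratForm a).toAffineMap, Set.univ, isOpen_univ, ?_⟩
  ext x
  simp [AffineSubspace.mem_mk', sub_eq_zero]

theorem IsRatHalfspace.exists_eq_iUnion {H : Set (ι → ℝ)} (h : IsRatHalfspace H) :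
    ∃ F : Bool → Set (ι → ℝ), (∀ t, IsRatRelOpen (F t)) ∧ H = ⋃ t, F t := by
  obtain ⟨a, b, rfl | rfl⟩ := h
  · refine ⟨fun t => cond t {x | ratForm a x = b} {x | ratForm a x < b}, ?_, ?_⟩
    · rintro (_ | _)
      · exact isRatRelOpen_lt a b
      · exact isRatRelOpen_eq a b
    · ext x
      simp [le_iff_lt_or_eq]
  · exact ⟨fun _ => _, fun _ => isRatRelOpen_lt a b, (Set.iUnion_const _).symm⟩

/-- A rational generalized polyhedron is a finite union of relatively open ones. -/
theorem IsRatGenPoly.exists_eq_iUnion {P : Set (ι → ℝ)} (hP : IsRatGenPoly P) :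
    ∃ (σ : Type) (_ : Finite σ) (F : σ → Set (ι → ℝ)), (∀ s, IsRatRelOpen (F s)) ∧
      P = ⋃ s, F s := by
  obtain ⟨𝓗, hfin, hH, rfl⟩ := hP
  have := hfin.to_subtype
  choose F hF hHF using fun H : 𝓗 => (hH H H.2).exists_eq_iUnion
  refine ⟨𝓗 → Bool, inferInstance, fun ε => ⋂ H, F H (ε H),
    fun ε => IsRatRelOpen.iInter fun H => hF H _, ?_⟩
  ext x
  rw [Set.sInter_eq_iInter, Set.mem_iUnion]
  simp only [Set.mem_iInter]
  -- Intersection distributes over the unions: one piece is chosen for each halfspace.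
  rw [← Classical.skolem (p := fun H t => x ∈ F H t)]
  refine forall_congr' fun H => ?_
  rw [← Set.mem_iUnion, ← hHF H]

end RelativelyOpen

/-! ### The inclusions between the four families -/

section Families

variable {n : ℕ} {𝒯 : SetFamily}

theorem iUnion_mem_finiteUnions {σ : Type*} [Finite σ] {F : σ → Set (Fin n → ℝ)}
    (h : ∀ s, F s ∈ 𝒯 n) : (⋃ s, F s) ∈ finiteUnions 𝒯 n := by
  obtain ⟨k, ⟨e⟩⟩ := Finite.exists_equiv_fin σ
  exact ⟨k, fun i => F (e.symm i), fun i => h _, (e.symm.iSup_comp (g := F)).symm⟩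

theorem iUnion_mem_finiteUnions_of_mem_finiteUnions {σ : Type*} [Finite σ]
    {F : σ → Set (Fin n → ℝ)} (h : ∀ s, F s ∈ finiteUnions 𝒯 n) :
    (⋃ s, F s) ∈ finiteUnions 𝒯 n := by
  choose k G hG hF using h
  rw [Set.iUnion_congr hF, ← Set.iUnion_sigma fun p : Σ s, Fin (k s) => G p.1 p.2]
  exact iUnion_mem_finiteUnions fun p => hG p.1 p.2

theorem mem_ratFGMonoids_of_fintype {σ : Type*} [Fintype σ] (r : σ → Fin n → ℚ) :
    {x | ∃ c : σ → ℕ, x = ∑ g, (c g : ℝ) • (fun j => (r g j : ℝ))} ∈ ratFGMonoids n := by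
  obtain ⟨k, ⟨e⟩⟩ := Finite.exists_equiv_fin σ
  refine ⟨k, fun i => r (e.symm i), ?_⟩
  ext x
  constructor
  · rintro ⟨c, rfl⟩
    refine ⟨fun i => c (e.symm i), fun j => ?_⟩
    rw [e.symm.sum_comp fun g => (c g : ℝ) * (r g j : ℝ)]
    simp
  · rintro ⟨c, hc⟩
    refine ⟨fun g => c (e g), ?_⟩
    ext j
    rw [hc j, ← e.sum_comp]
    simp

variable {κ : Type} [Fintype κ]

/-- Mixed-integer sets over an arbitrary finite index type. -/
def IsMixedInteger (T : Set (κ → ℝ)) : Prop :=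
  ∃ (P : Set (κ → ℝ)) (I : Set κ), IsRatGenPoly P ∧
    T = {x | x ∈ P ∧ ∀ i ∈ I, ∃ z : ℤ, x i = (z : ℝ)}

theorem mem_ratGenMixedIntegerSets_iff {T : Set (Fin n → ℝ)} :
    T ∈ ratGenMixedIntegerSets n ↔ IsMixedInteger T := by
  constructor
  · rintro ⟨P, hP, I, rfl⟩
    exact ⟨P, I, mem_ratGenPolyhedra_iff.1 hP, rfl⟩
  · rintro ⟨P, I, hP, rfl⟩
    exact ⟨P, mem_ratGenPolyhedra_iff.2 hP, I, rfl⟩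

theorem IsMixedInteger.reindex {κ' : Type} [Fintype κ'] {T : Set (κ → ℝ)} (h : IsMixedInteger T)
    (e : κ ≃ κ') : IsMixedInteger {x : κ' → ℝ | x ∘ e ∈ T} := by
  obtain ⟨P, I, hP, rfl⟩ := h
  refine ⟨{x | x ∘ e ∈ P}, e '' I, isRatGenPoly_preimage_comp hP e, ?_⟩
  ext x
  simp only [Set.mem_ofPred_eq, Set.forall_mem_image, Function.comp_apply]

theorem ratMap_image_reindex {m : ℕ} (e : κ ≃ Fin m) (L : Matrix (Fin n) κ ℚ) (T : Set (κ → ℝ)) :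
    ratMap L '' T = ratMap (Matrix.of fun i j => L i (e.symm j)) '' {x : Fin m → ℝ | x ∘ e ∈ T} := by
  have key (x : Fin m → ℝ) : ratMap (Matrix.of fun i j => L i (e.symm j)) x = ratMap L (x ∘ e) := by
    ext i
    rw [ratMap_apply, ratMap_apply, ← e.sum_comp]
    exact Finset.sum_congr rfl fun j _ => by simp
  ext y
  constructor
  · rintro ⟨x, hx, rfl⟩
    have hxe : (x ∘ e.symm) ∘ e = x := by ext j; simp
    exact ⟨x ∘ e.symm, by rwa [Set.mem_ofPred_eq, hxe], by rw [key, hxe]⟩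
  · rintro ⟨x, hx, rfl⟩
    exact ⟨x ∘ e, hx, (key x).symm⟩

theorem ratMap_image_mem_ratRepresentable {T : Set (κ → ℝ)} (h : IsMixedInteger T)
    (L : Matrix (Fin n) κ ℚ) :
    ratMap L '' T ∈ ratRepresentable ratGenMixedIntegerSets n := by
  obtain ⟨m, ⟨e⟩⟩ := Finite.exists_equiv_fin κ
  exact ⟨m, _, _, mem_ratGenMixedIntegerSets_iff.2 (h.reindex e), ratMap_image_reindex e L T⟩

theorem ratMap_image_iUnion_mem_ratRepresentable {σ : Type*} [Finite σ] {T : σ → Set (κ → ℝ)}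
    (h : ∀ s, IsMixedInteger (T s)) (L : Matrix (Fin n) κ ℚ) :
    ratMap L '' ⋃ s, T s ∈ ratRepresentable (finiteUnions ratGenMixedIntegerSets) n := by
  obtain ⟨m, ⟨e⟩⟩ := Finite.exists_equiv_fin κ
  refine ⟨m, ⋃ s, {x | x ∘ e ∈ T s}, Matrix.of fun i j => L i (e.symm j), iUnion_mem_finiteUnions fun s =>
    mem_ratGenMixedIntegerSets_iff.2 ((h s).reindex e), ?_⟩
  rw [ratMap_image_reindex e L]
  simp only [Set.mem_iUnion, Set.ofPred_exists]
  rfl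

theorem ratRepresentable_finiteUnions_subset (𝒯 : SetFamily) :
    ratRepresentable (finiteUnions 𝒯) n ⊆ finiteUnions (ratRepresentable 𝒯) n := by
  rintro _ ⟨m, _, L, ⟨k, F, hF, rfl⟩, rfl⟩
  exact ⟨k, fun i => _, fun i => ⟨m, F i, L, hF i, rfl⟩, Set.image_iUnion⟩

/-- The source spaces have different dimensions, so each is embedded as a block of their direct sum,
with zeros in the other blocks. The matrices placed side by side then act on every block at once. -/
theorem finiteUnions_ratRepresentable_mixedInteger_subset :
    finiteUnions (ratRepresentable ratGenMixedIntegerSets) n ⊆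
      ratRepresentable (finiteUnions ratGenMixedIntegerSets) n := by
  classical
  rintro _ ⟨k, F, hF, rfl⟩
  choose m T L hT hF using hF
  choose P I hP hTP using fun i => mem_ratGenMixedIntegerSets_iff.1 (hT i)
  let U (i : Fin k) : Set ((Σ i, Fin (m i)) → ℝ) :=
    {z | (fun j => z ⟨i, j⟩) ∈ T i ∧ ∀ j : Σ i, Fin (m i), j.1 ≠ i → z j = 0}
  have hU (i : Fin k) : IsMixedInteger (U i) := by
    refine ⟨{z | z ∘ Sigma.mk i ∈ P i} ∩
      ⋂ j : {j : Σ i, Fin (m i) // j.1 ≠ i}, {z | z j = (0 : ℚ)}, Sigma.mk i '' I i,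
      (isRatGenPoly_preimage_comp (hP i) _).inter
        (IsRatGenPoly.iInter fun j => isRatGenPoly_coord_eq _ _), ?_⟩
    ext z
    simp only [U, hTP i, Set.mem_ofPred_eq, Set.mem_inter_iff, Set.mem_iInter, Subtype.forall,
      Set.forall_mem_image, Rat.cast_zero, Function.comp_def]
    tauto
  convert ratMap_image_iUnion_mem_ratRepresentable hU (Matrix.of fun a j => L j.1 a j.2) using 1
  rw [Set.image_iUnion]
  refine Set.iUnion_congr fun i => ?_
  have key (z : (Σ i, Fin (m i)) → ℝ) (hz : ∀ j : Σ i, Fin (m i), j.1 ≠ i → z j = 0) :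
      ratMap (Matrix.of fun a (j : Σ i, Fin (m i)) => L j.1 a j.2) z =
        ratMap (L i) fun j => z ⟨i, j⟩ := by
    ext a
    rw [ratMap_apply, ratMap_apply, Fintype.sum_sigma, Finset.sum_eq_single i]
    · rfl
    · intro i' _ hi'
      exact Finset.sum_eq_zero fun j _ => by rw [hz ⟨i', j⟩ hi', mul_zero]
    · simp
  rw [hF i]
  ext y
  constructor
  · rintro ⟨x, hx, rfl⟩
    let z (j : Σ i, Fin (m i)) : ℝ := if h : j.1 = i then x (h ▸ j.2) else 0
    have hz : (fun j => z ⟨i, j⟩) = x := by ext j; simp [z]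
    have hz0 (j : Σ i, Fin (m i)) (hj : j.1 ≠ i) : z j = 0 := dif_neg hj
    exact ⟨z, ⟨by rwa [hz], hz0⟩, by rw [key z hz0, hz]; rfl⟩
  · rintro ⟨z, hz, rfl⟩
    exact ⟨_, hz.1, (key z hz.2).symm⟩

/-- A linear map commutes with unions and Minkowski sums, so it applies to the bounded parts and to
the monoid generators separately. -/
theorem ratRepresentable_mixedInteger_subset :
    ratRepresentable ratGenMixedIntegerSets n ⊆
      finiteUnions (minkowskiSums ratGenPolytopes ratFGMonoids) n := by
  rintro _ ⟨m, _, L, ⟨P, hP, I, rfl⟩, rfl⟩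
  obtain ⟨σ, τ, _, _, r, D, hD, hT⟩ :=
    (mem_ratGenPolyhedra_iff.1 hP).exists_mixedInteger_eq_iUnion I
  change ratMap L '' _ ∈ _
  rw [hT, Set.image_iUnion]
  refine iUnion_mem_finiteUnions fun t => ⟨ratMap L '' D t,
    ⟨mem_ratGenPolyhedra_iff.2 ((hD t).1.image L),
      (LinearMap.toContinuousLinearMap (ratMap L)).lipschitz.isBounded_image (hD t).2⟩, _,
    mem_ratFGMonoids_of_fintype fun g i => ∑ j, L i j * r g j, ?_⟩
  rw [Set.image_add]
  congr 1
  have key (c : σ → ℕ) : ratMap L (∑ g, (c g : ℝ) • intVec (r g)) =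
      ∑ g, (c g : ℝ) • (fun i => ((∑ j, L i j * r g j : ℚ) : ℝ)) := by
    rw [map_sum]
    refine Finset.sum_congr rfl fun g _ => ?_
    rw [map_smul]
    congr 1
    ext i
    simp [ratMap_apply]
  ext y
  constructor
  · rintro ⟨_, ⟨c, rfl⟩, rfl⟩
    exact ⟨c, key c⟩
  · rintro ⟨c, rfl⟩
    exact ⟨_, ⟨c, rfl⟩, key c⟩

theorem minkowskiSums_ratGenPolytopes_subset_finiteUnions (𝒰 : SetFamily) :
    minkowskiSums ratGenPolytopes 𝒰 n ⊆
      finiteUnions (minkowskiSums ratRelOpenPolytopes 𝒰) n := by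
  rintro _ ⟨P, ⟨hP, hbdd⟩, M, hM, rfl⟩
  obtain ⟨σ, _, F, hF, rfl⟩ := (mem_ratGenPolyhedra_iff.1 hP).exists_eq_iUnion
  rw [Set.iUnion_add]
  refine iUnion_mem_finiteUnions fun s => ⟨F s, ⟨⟨mem_ratGenPolyhedra_iff.2 (hF s).1, ?_⟩,
    hbdd.subset (Set.subset_iUnion F s)⟩, M, hM, rfl⟩
  obtain ⟨A, O, hO, hs⟩ := (hF s).2
  exact intrinsicInterior_eq_self_of_eq_inter hO hs

/-- The sum is the image of pairs (p, c), with c integral and nonnegative, under (p, c) ↦ p + ∑ cᵢ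
rᵢ. -/
theorem minkowskiSums_ratGenPolytopes_subset_ratRepresentable :
    minkowskiSums ratGenPolytopes ratFGMonoids n ⊆ ratRepresentable ratGenMixedIntegerSets n := by
  classical
  rintro _ ⟨P, ⟨hP, -⟩, _, ⟨k, r, rfl⟩, rfl⟩
  have hT : IsMixedInteger {z : Fin n ⊕ Fin k → ℝ | z ∘ Sum.inl ∈ P ∧
      ∀ i, ∃ c : ℕ, z (Sum.inr i) = (c : ℝ)} := by
    refine ⟨{z | z ∘ Sum.inl ∈ P} ∩ ⋂ i : Fin k, {z | ((0 : ℚ) : ℝ) ≤ z (Sum.inr i)},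
      Set.range Sum.inr, (isRatGenPoly_preimage_comp (mem_ratGenPolyhedra_iff.1 hP) _).inter
        (IsRatGenPoly.iInter fun i => isRatGenPoly_coord_ge _ _), ?_⟩
    ext z
    simp only [Set.mem_ofPred_eq, Set.mem_inter_iff, Set.mem_iInter, Set.forall_mem_range,
      Rat.cast_zero, and_assoc, ← forall_and]
    refine and_congr_right fun _ => forall_congr' fun i => ⟨?_, ?_⟩
    · rintro ⟨c, hc⟩
      exact ⟨hc ▸ Nat.cast_nonneg c, c, by simpa using hc⟩
    · rintro ⟨h0, c, hc⟩
      rw [hc] at h0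
      lift c to ℕ using by exact_mod_cast h0
      exact ⟨c, by simpa using hc⟩
  have key (z : Fin n ⊕ Fin k → ℝ) (j : Fin n) :
      ratMap (Matrix.of fun j : Fin n => Sum.elim (Pi.single j 1) fun i => r i j) z j =
        z (Sum.inl j) + ∑ i, z (Sum.inr i) * (r i j : ℝ) := by
    rw [ratMap_apply, Fintype.sum_sum_type]
    congr 1
    · exact ratForm_single j fun i => z (Sum.inl i)
    · exact Finset.sum_congr rfl fun i _ => mul_comm _ _
  convert ratMap_image_mem_ratRepresentable hT
    (Matrix.of fun j : Fin n => Sum.elim (Pi.single j 1) fun i => r i j) using 1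
  ext x
  constructor
  · rintro ⟨p, hp, y, ⟨c, hc⟩, rfl⟩
    refine ⟨Sum.elim p fun i => (c i : ℝ), ⟨hp, fun i => ⟨c i, rfl⟩⟩, ?_⟩
    ext j
    rw [key]
    simp [hc]
  · rintro ⟨z, ⟨hp, hz⟩, rfl⟩
    choose c hc using hz
    refine ⟨_, hp, fun j => ∑ i, (c i : ℝ) * (r i j : ℝ), ⟨c, fun j => rfl⟩, ?_⟩
    ext j
    rw [key]
    simp [hc]

theorem finiteUnions_subset_of_subset {𝒯 𝒰 : SetFamily} (h : 𝒯 n ⊆ 𝒰 n) :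
    finiteUnions 𝒯 n ⊆ finiteUnions 𝒰 n := by
  rintro _ ⟨k, F, hF, rfl⟩
  exact ⟨k, F, fun i => h (hF i), rfl⟩

theorem finiteUnions_subset_of_subset_finiteUnions {𝒯 𝒰 : SetFamily}
    (h : 𝒯 n ⊆ finiteUnions 𝒰 n) : finiteUnions 𝒯 n ⊆ finiteUnions 𝒰 n := by
  rintro _ ⟨k, F, hF, rfl⟩
  exact iUnion_mem_finiteUnions_of_mem_finiteUnions fun i => h (hF i)

theorem minkowskiSums_ratRelOpenPolytopes_subset (𝒰 : SetFamily) :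
    minkowskiSums ratRelOpenPolytopes 𝒰 n ⊆ minkowskiSums ratGenPolytopes 𝒰 n := by
  rintro _ ⟨P, hP, M, hM, rfl⟩
  exact ⟨P, ⟨hP.1.1, hP.2⟩, M, hM, rfl⟩

end Families

end GenMILP

theorem theorem5p7 (n : ℕ) (S : Set (Fin n → ℝ)) :
    List.TFAE [
      S ∈ GenMILP.ratRepresentable (GenMILP.finiteUnions GenMILP.ratGenMixedIntegerSets) n,
      S ∈ GenMILP.finiteUnions (GenMILP.ratRepresentable GenMILP.ratGenMixedIntegerSets) n,
      S ∈ GenMILP.finiteUnions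
        (GenMILP.minkowskiSums GenMILP.ratRelOpenPolytopes GenMILP.ratFGMonoids) n,
      S ∈ GenMILP.finiteUnions
        (GenMILP.minkowskiSums GenMILP.ratGenPolytopes GenMILP.ratFGMonoids) n] := by
  tfae_have 1 → 2 := fun h => GenMILP.ratRepresentable_finiteUnions_subset _ h
  tfae_have 2 → 1 := fun h => GenMILP.finiteUnions_ratRepresentable_mixedInteger_subset h
  tfae_have 2 → 4 := fun h => GenMILP.finiteUnions_subset_of_subset_finiteUnions
    GenMILP.ratRepresentable_mixedInteger_subset h
  tfae_have 4 → 2 := fun h => GenMILP.finiteUnions_subset_of_subset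
    GenMILP.minkowskiSums_ratGenPolytopes_subset_ratRepresentable h
  tfae_have 4 → 3 := fun h => GenMILP.finiteUnions_subset_of_subset_finiteUnions
    (GenMILP.minkowskiSums_ratGenPolytopes_subset_finiteUnions _) h
  tfae_have 3 → 4 := fun h => GenMILP.finiteUnions_subset_of_subset
    (GenMILP.minkowskiSums_ratRelOpenPolytopes_subset _) h
  tfae_finish
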